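/- Let $\mathcal S$ be the centrally extended complex Schrödinger algebra, i.e. the complex Lie algebra with basis $f,q,h,z,p,e$ and brackets $[h,e]=2e$, $[h,p]=p$, $[h,f]=-2f$, $[e,q]=p$, $[e,p]=0$, $[e,f]=h$, $[p,f]=-q$, $[f,q]=0$, $[h,q]=-q$, $[p,q]=z$, $[z,\mathcal S]=0$, and let $U$ be its universal enveloping algebra. Let $U^{(q)}$ be the Ore localization of $U$ with respect to the powers of $q$, and for $x\in\mathbb C$ let $\Theta_x$ be the automorphism of $U^{(q)}$ with $$\Theta_x(q^{\pm1})=q^{\pm1},\quad \Theta_x(f)=f,\quad \Theta_x(z)=z,\quad \Theta_x(h)=h-x,\quad \Theta_x(p)=p+xq^{-1}z,\quad \Theta_x(e)=e+xq^{-1}p+\tfrac12x(x-1)q^{-2}z.$$ For a $U$-module $V$ let $B^{(q)}_x(V)$ be the vector space $U^{(q)}\otimes_U V$ on which $u\in U$ acts as $\Theta_x(u)$ acts by left multiplication on the first factor. For $\lambda\in-\frac12+\mathbb Z_{\ge0}$ and $c\in\mathbb C\setminus\{0\}$ let $N(\lambda,c)$ be the $U$-module with basis $w_{i,j}$ ($i,j\in\mathbb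 Z_{\ge0}$, $j\le\lambda+\frac12$) and action $$\begin{aligned} q\,w_{i,j}&=w_{i+1,j},\\ f\,w_{i,j}&=\begin{cases}w_{i,j+1},& j<\lambda+\frac12,\\ -\sum_{s=0}^{\lambda+\frac12}\frac{1}{(2c)^{\lambda+\frac32-s}}\binom{\lambda+\frac32}{s}\,w_{i+2\lambda+3-2s,\,s},& j=\lambda+\frac12,\end{cases}\\ z\,w_{i,j}&=c\,w_{i,j},\qquad h\,w_{i,j}=(\lambda-i-2j)\,w_{i,j},\\ p\,w_{i,j}&=-j\,w_{i+1,j-1}+c\,i\,w_{i-1,j},\\ e\,w_{i,j}&=j(\lambda+1-i-j)\,w_{i,j-1}+\tfrac12c\,i(i-1)\,w_{i-2,j}, \end{aligned}$$ where terms with coefficient $0$ are omitted. **Proposition.** Let $\lambda\in-\frac12+\mathbb Z_{\ge0}$, $c\in\mathbb C\setminus\{0\}$ and $x\in\mathbb C$, let $v$ be a (nonzero) highest weight vector of $N(\lambda,c)$, and put $v_{i,j}=q^if^j\otimes v\in B^{(q)}_x(N(\lambda,c))$ for integers $i$ and $j$ with $j\ge0$. Then the vectors $v_{i,j}$ with $i,j\in\mathbb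 Z$ and $0\le j\le\lambda+\frac12$ form a basis of $B^{(q)}_x(N(\lambda,c))$, and in this basis $U$ acts by $$\begin{aligned} q\,v_{i,j}&=v_{i+1,j},\\ f\,v_{i,j}&=\begin{cases}v_{i,j+1},& j<\lambda+\frac12,\\ -\sum_{s=0}^{\lambda+\frac12}\frac{1}{(2c)^{\lambda+\frac32-s}}\binom{\lambda+\frac32}{s}\,v_{i+2\lambda+3-2s,\,s},& j=\lambda+\frac12,\end{cases}\\ z\,v_{i,j}&=c\,v_{i,j},\\ h\,v_{i,j}&=(\lambda-(i+x)-2j)\,v_{i,j},\\ p\,v_{i,j}&=-j\,v_{i+1,j-1}+c(i+x)\,v_{i-1,j},\\ e\,v_{i,j}&=j(\lambda+1-(i+x)-j)\,v_{i,j-1}+\tfrac12c(i+x)\big((i+x)-1\big)\,v_{i-2,j}, \end{aligned}$$ where terms with coefficient $j=0$ are omitted. -/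

import Mathlib

set_option linter.unusedSimpArgs false

namespace Schrodinger

attribute [local instance 100] LieRing.ofAssociativeRing

/-! ## The Schrödinger algebra and its enveloping algebra -/

/-- Labels of the six basis elements of the Schrödinger algebra. -/
inductive Gen
  | f | q | h | z | p | e

/-- The underlying vector space of the (centrally extended) Schrödinger algebra: complex linear
combinations of the six basis elements; `X g` is the coefficient of `g` in `X`. -/
def Sch : Type := Gen → ℂ

namespace Sch

instance : AddCommGroup Sch := inferInstanceAs (AddCommGroup (Gen → ℂ))
instance : Module ℂ Sch := inferInstanceAs (Module ℂ (Gen → ℂ))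

@[ext] theorem ext {X Y : Sch} (H : ∀ g, X g = Y g) : X = Y := funext H

@[simp] theorem add_apply (X Y : Sch) (g : Gen) : (X + Y) g = X g + Y g := rfl
@[simp] theorem smul_apply (a : ℂ) (X : Sch) (g : Gen) : (a • X) g = a * X g := rfl
@[simp] theorem neg_apply (X : Sch) (g : Gen) : (-X) g = -X g := rfl
@[simp] theorem zero_apply (g : Gen) : (0 : Sch) g = 0 := rfl

/-- The bracket, in coordinates. -/
instance : Bracket Sch Sch where
  bracket X Y := fun
    | .f => -2 * (X .h * Y .f - X .f * Y .h)
    | .q => -(X .p * Y .f - X .f * Y .p) - (X .h * Y .q - X .q * Y .h)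
    | .h => X .e * Y .f - X .f * Y .e
    | .z => X .p * Y .q - X .q * Y .p
    | .p => (X .h * Y .p - X .p * Y .h) + (X .e * Y .q - X .q * Y .e)
    | .e => 2 * (X .h * Y .e - X .e * Y .h)

theorem bracket_f (X Y : Sch) : ⁅X, Y⁆ .f = -2 * (X .h * Y .f - X .f * Y .h) := rfl
theorem bracket_q (X Y : Sch) :
    ⁅X, Y⁆ .q = -(X .p * Y .f - X .f * Y .p) - (X .h * Y .q - X .q * Y .h) := rfl
theorem bracket_h (X Y : Sch) : ⁅X, Y⁆ .h = X .e * Y .f - X .f * Y .e := rfl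
theorem bracket_z (X Y : Sch) : ⁅X, Y⁆ .z = X .p * Y .q - X .q * Y .p := rfl
theorem bracket_p (X Y : Sch) :
    ⁅X, Y⁆ .p = (X .h * Y .p - X .p * Y .h) + (X .e * Y .q - X .q * Y .e) := rfl
theorem bracket_e (X Y : Sch) : ⁅X, Y⁆ .e = 2 * (X .h * Y .e - X .e * Y .h) := rfl

instance : LieRing Sch where
  add_lie X Y Z := by
    ext g; cases g <;>
      simp only [bracket_f, bracket_q, bracket_h, bracket_z, bracket_p, bracket_e, add_apply] <;>
      ring
  lie_add X Y Z := by
    ext g; cases g <;>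
      simp only [bracket_f, bracket_q, bracket_h, bracket_z, bracket_p, bracket_e, add_apply] <;>
      ring
  lie_self X := by
    ext g; cases g <;>
      simp only [bracket_f, bracket_q, bracket_h, bracket_z, bracket_p, bracket_e, zero_apply] <;>
      ring
  leibniz_lie X Y Z := by
    ext g; cases g <;>
      simp only [bracket_f, bracket_q, bracket_h, bracket_z, bracket_p, bracket_e, add_apply] <;>
      ring

instance : LieAlgebra ℂ Sch where
  lie_smul a X Y := by
    ext g; cases g <;>
      simp only [bracket_f, bracket_q, bracket_h, bracket_z, bracket_p, bracket_e, smul_apply] <;>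
      ring

/-- The basis element with label `g`. -/
def gen (g : Gen) : Sch := fun g' => match g, g' with
  | .f, .f => 1
  | .q, .q => 1
  | .h, .h => 1
  | .z, .z => 1
  | .p, .p => 1
  | .e, .e => 1
  | _, _ => 0

theorem eq_sum_gen (X : Sch) :
    X = X .f • gen .f + X .q • gen .q + X .h • gen .h + X .z • gen .z + X .p • gen .p
      + X .e • gen .e := by
  ext g; cases g <;> simp [gen]

/-- The defining table of brackets. -/
theorem bracket_table :
    ⁅gen .h, gen .e⁆ = (2 : ℂ) • gen .e ∧ ⁅gen .h, gen .p⁆ = gen .p ∧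
    ⁅gen .h, gen .f⁆ = (-2 : ℂ) • gen .f ∧ ⁅gen .e, gen .q⁆ = gen .p ∧
    ⁅gen .e, gen .p⁆ = 0 ∧ ⁅gen .e, gen .f⁆ = gen .h ∧ ⁅gen .p, gen .f⁆ = -gen .q ∧
    ⁅gen .f, gen .q⁆ = 0 ∧ ⁅gen .h, gen .q⁆ = -gen .q ∧ ⁅gen .p, gen .q⁆ = gen .z ∧
    ∀ X : Sch, ⁅gen .z, X⁆ = 0 := by
  refine ⟨?_, ?_, ?_, ?_, ?_, ?_, ?_, ?_, ?_, ?_, fun X => ?_⟩ <;>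
    (ext g; cases g <;>
      simp [bracket_f, bracket_q, bracket_h, bracket_z, bracket_p, bracket_e, gen])

end Sch

/-- Six elements of an associative algebra satisfying the commutation relations of the
Schrödinger algebra. -/
structure Rels {A : Type*} [Ring A] [Algebra ℂ A] (a : Gen → A) : Prop where
  he : ⁅a .h, a .e⁆ = (2 : ℂ) • a .e
  hp : ⁅a .h, a .p⁆ = a .p
  hf : ⁅a .h, a .f⁆ = (-2 : ℂ) • a .f
  eq : ⁅a .e, a .q⁆ = a .p
  ep : ⁅a .e, a .p⁆ = 0
  ef : ⁅a .e, a .f⁆ = a .h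
  pf : ⁅a .p, a .f⁆ = -a .q
  fq : ⁅a .f, a .q⁆ = 0
  hq : ⁅a .h, a .q⁆ = -a .q
  pq : ⁅a .p, a .q⁆ = a .z
  zg : ∀ g, ⁅a .z, a g⁆ = 0

/-- The linear map extending a choice of images of the basis elements. -/
def genLin {M : Type*} [AddCommGroup M] [Module ℂ M] (a : Gen → M) : Sch →ₗ[ℂ] M where
  toFun X := X .f • a .f + X .q • a .q + X .h • a .h + X .z • a .z + X .p • a .p + X .e • a .e
  map_add' X Y := by simp only [Sch.add_apply]; module
  map_smul' t X := by simp only [Sch.smul_apply, RingHom.id_apply]; module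

theorem genLin_gen {M : Type*} [AddCommGroup M] [Module ℂ M] (a : Gen → M) (g : Gen) :
    genLin a (Sch.gen g) = a g := by
  cases g <;> simp [genLin, Sch.gen]

theorem genLin_apply {M : Type*} [AddCommGroup M] [Module ℂ M] (a : Gen → M) (X : Sch) :
    genLin a X = X .f • a .f + X .q • a .q + X .h • a .h + X .z • a .z + X .p • a .p
      + X .e • a .e := rfl

/-- The Lie algebra homomorphism given by elements satisfying the commutation relations. -/
def genLie {A : Type*} [Ring A] [Algebra ℂ A] (a : Gen → A) (H : Rels a) : Sch →ₗ⁅ℂ⁆ A :=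
  { genLin a with
    map_lie' := by
      intro X Y
      have sk : ∀ g g' : Gen, ⁅a g, a g'⁆ = -⁅a g', a g⁆ := fun g g' => (lie_skew _ _).symm
      change genLin a ⁅X, Y⁆ = ⁅genLin a X, genLin a Y⁆
      simp only [genLin_apply, Sch.bracket_f, Sch.bracket_q, Sch.bracket_h, Sch.bracket_z,
        Sch.bracket_p, Sch.bracket_e, lie_add, add_lie, lie_smul, smul_lie, lie_self,
        H.he, H.hp, H.hf, H.eq, H.ep, H.ef, H.pf, H.fq, H.hq, H.pq, H.zg,
        sk .e .h, sk .p .h, sk .f .h, sk .q .e, sk .p .e, sk .f .e, sk .f .p, sk .q .f,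
        sk .q .h, sk .q .p, sk .f .z, sk .q .z, sk .h .z, sk .p .z, sk .e .z]
      module }

/-- The universal enveloping algebra of the Schrödinger algebra. -/
abbrev U : Type := UniversalEnvelopingAlgebra ℂ Sch

namespace U

/-- The image in `U` of the basis element with label `g`. -/
noncomputable def gen (g : Gen) : U := UniversalEnvelopingAlgebra.ι ℂ (Sch.gen g)

theorem rels : Rels gen := by
  obtain ⟨h1, h2, h3, h4, h5, h6, h7, h8, h9, h10, h11⟩ := Sch.bracket_table
  constructor
  all_goals try intro g
  all_goals simp only [gen, ← LieHom.map_lie, h1, h2, h3, h4, h5, h6, h7, h8, h9, h10, h11,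
    map_smul, map_neg, map_zero]

/-- The algebra homomorphism out of `U` given by elements satisfying the commutation relations. -/
noncomputable def lift {A : Type*} [Ring A] [Algebra ℂ A] (a : Gen → A) (H : Rels a) :
    U →ₐ[ℂ] A :=
  UniversalEnvelopingAlgebra.lift ℂ (genLie a H)

theorem lift_gen {A : Type*} [Ring A] [Algebra ℂ A] (a : Gen → A) (H : Rels a) (g : Gen) :
    lift a H (gen g) = a g :=
  (UniversalEnvelopingAlgebra.lift_ι_apply ℂ _ _).trans (genLin_gen a g)

theorem hom_ext {A : Type*} [Ring A] [Algebra ℂ A] {φ ψ : U →ₐ[ℂ] A}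
    (H : ∀ g, φ (gen g) = ψ (gen g)) : φ = ψ := by
  apply UniversalEnvelopingAlgebra.hom_ext
  ext X
  change φ (UniversalEnvelopingAlgebra.ι ℂ X) = ψ (UniversalEnvelopingAlgebra.ι ℂ X)
  have H' : ∀ g, φ (UniversalEnvelopingAlgebra.ι ℂ (Sch.gen g)) =
      ψ (UniversalEnvelopingAlgebra.ι ℂ (Sch.gen g)) := H
  rw [X.eq_sum_gen]
  simp only [map_add, map_smul, H']

/-- A subalgebra containing the generators is everything. -/
theorem mem_of_gen (B : Subalgebra ℂ U) (H : ∀ g, gen g ∈ B) (u : U) : u ∈ B := by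
  let a : Gen → B := fun g => ⟨gen g, H g⟩
  have ra : Rels a := by
    obtain ⟨h1, h2, h3, h4, h5, h6, h7, h8, h9, h10, h11⟩ := rels
    constructor
    all_goals try intro g
    all_goals apply Subtype.ext
    exacts [h1, h2, h3, h4, h5, h6, h7, h8, h9, h10, h11 g]
  have : B.val.comp (lift a ra) = AlgHom.id ℂ U := hom_ext fun g => by
    simp only [AlgHom.comp_apply, lift_gen]; rfl
  have h2 := DFunLike.congr_fun this u
  simp only [AlgHom.comp_apply, AlgHom.id_apply] at h2
  rw [← h2]
  exact (lift a ra u).2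

end U

/-! ## Localization at `q` -/

section LocallyNilpotent

variable {R : Type*} [Ring R] [Algebra ℂ R]

/-- The adjoint action `a ↦ u a - a u`. -/
def adj (u : R) : R →ₗ[ℂ] R := LinearMap.mulLeft ℂ u - LinearMap.mulRight ℂ u

theorem adj_apply (u a : R) : adj u a = u * a - a * u := rfl

theorem adj_zero_of_le (u a : R) {m n : ℕ} (h : m ≤ n) (H : (adj u)^[m] a = 0) :
    (adj u)^[n] a = 0 := by
  obtain ⟨k, rfl⟩ := Nat.exists_eq_add_of_le' h
  rw [Function.iterate_add_apply, H, Function.iterate_fixed (map_zero _)]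

theorem adj_iter_add (u a b : R) (n : ℕ) :
    (adj u)^[n] (a + b) = (adj u)^[n] a + (adj u)^[n] b := by
  rw [← Module.End.pow_apply, map_add, Module.End.pow_apply, Module.End.pow_apply]

theorem adj_mul (u : R) (k : ℕ) : ∀ (m n : ℕ) (a b : R), m + n = k → (adj u)^[m] a = 0 →
    (adj u)^[n] b = 0 → (adj u)^[k] (a * b) = 0 := by
  induction k with
  | zero =>
    intro m n a b h ha _
    obtain rfl : m = 0 := by omega
    have : a = 0 := ha
    simp [this]
  | succ k ih =>
    intro m n a b h ha hb
    have e1 : adj u (a * b) = adj u a * b + a * adj u b := by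
      simp only [adj_apply]; noncomm_ring
    rw [Function.iterate_succ_apply, e1, adj_iter_add]
    rcases m with _ | m
    · have : a = 0 := ha
      subst this
      simp [Function.iterate_fixed (map_zero (adj u))]
    rcases n with _ | n
    · have : b = 0 := hb
      subst this
      simp [Function.iterate_fixed (map_zero (adj u))]
    rw [ih m (n + 1) (adj u a) b (by omega) ha hb, ih (m + 1) n a (adj u b) (by omega) ha hb,
      add_zero]

/-- The subalgebra of elements on which the adjoint action of `u` is nilpotent. -/
def locNil (u : R) : Subalgebra ℂ R where
  carrier := {a | ∃ n, (adj u)^[n] a = 0}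
  mul_mem' := by
    rintro a b ⟨m, hm⟩ ⟨n, hn⟩
    exact ⟨m + n, adj_mul u _ m n a b rfl hm hn⟩
  add_mem' := by
    rintro a b ⟨m, hm⟩ ⟨n, hn⟩
    refine ⟨m + n, ?_⟩
    rw [adj_iter_add, adj_zero_of_le u a (by omega) hm, adj_zero_of_le u b (by omega) hn, add_zero]
  algebraMap_mem' r := ⟨1, by simp [adj_apply, Algebra.commutes]⟩

theorem ore_exists (u : R) (k : ℕ) : ∀ (a : R), (adj u)^[k] a = 0 → ∀ m : ℕ,
    ∃ b, u ^ (m + k) * a = b * u ^ m := by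
  induction k with
  | zero =>
    intro a ha m
    have : a = 0 := ha
    exact ⟨0, by simp [this]⟩
  | succ k ih =>
    intro a ha m
    induction m with
    | zero => exact ⟨u ^ (k + 1) * a, by simp⟩
    | succ m ihm =>
      obtain ⟨b, hb⟩ := ihm
      obtain ⟨b', hb'⟩ := ih (adj u a) ha (m + 1)
      refine ⟨b + b', ?_⟩
      have e1 : u * a = a * u + adj u a := by rw [adj_apply]; abel
      calc u ^ (m + 1 + (k + 1)) * a = u ^ (m + (k + 1)) * (u * a) := by
            rw [← mul_assoc, ← pow_succ]; congr 2; omega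
        _ = u ^ (m + (k + 1)) * a * u + u ^ (m + 1 + k) * adj u a := by
            rw [e1, mul_add, mul_assoc]; congr 3; omega
        _ = (b + b') * u ^ (m + 1) := by
            rw [hb, hb', add_mul, mul_assoc, ← pow_succ]

theorem ore_cancel_one (u : R) (k : ℕ) : ∀ a : R, (adj u)^[k] a = 0 → a * u = 0 →
    u ^ k * a = 0 := by
  induction k with
  | zero => intro a ha _; have : a = 0 := ha; simp [this]
  | succ k ih =>
    intro a ha h
    have e1 : adj u a = u * a := by rw [adj_apply, h, sub_zero]
    have := ih (adj u a) ha (by rw [e1, mul_assoc, h, mul_zero])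
    rw [pow_succ, mul_assoc, ← e1, this]

theorem ore_cancel (u : R) (H : ∀ a, a ∈ locNil u) (m : ℕ) : ∀ a : R, a * u ^ m = 0 →
    ∃ k : ℕ, u ^ k * a = 0 := by
  induction m with
  | zero => intro a ha; exact ⟨0, by simpa using ha⟩
  | succ m ih =>
    intro a ha
    obtain ⟨k, hk⟩ := H (a * u ^ m)
    have h1 := ore_cancel_one u k _ hk (by rw [mul_assoc, ← pow_succ, ha])
    obtain ⟨l, hl⟩ := ih (u ^ k * a) (by rw [mul_assoc, h1])
    exact ⟨l + k, by rw [pow_add, mul_assoc, hl]⟩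

/-- The powers of an element with locally nilpotent adjoint action form an Ore set. -/
noncomputable abbrev oreSetOfLocNil (u : R) (H : ∀ a, a ∈ locNil u) :
    OreLocalization.OreSet (Submonoid.powers u) :=
  have ex : ∀ (r : R) (s : Submonoid.powers u),
      ∃ (b : R) (t : Submonoid.powers u), (t : R) * r = b * s := by
    rintro r ⟨_, m, rfl⟩
    obtain ⟨k, hk⟩ := H r
    obtain ⟨b, hb⟩ := ore_exists u k r hk m
    exact ⟨b, ⟨u ^ (m + k), m + k, rfl⟩, hb⟩
  { ore_right_cancel := by
      rintro r₁ r₂ ⟨_, m, rfl⟩ h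
      obtain ⟨k, hk⟩ := ore_cancel u H m (r₁ - r₂) (by
        rw [sub_mul]; exact sub_eq_zero.mpr h)
      refine ⟨⟨u ^ k, k, rfl⟩, ?_⟩
      rw [mul_sub] at hk
      exact sub_eq_zero.mp hk
    oreNum := fun r s => (ex r s).choose
    oreDenom := fun r s => (ex r s).choose_spec.choose
    ore_eq := fun r s => (ex r s).choose_spec.choose_spec }

end LocallyNilpotent

namespace U

theorem mem_locNil_q (u : U) : u ∈ locNil (gen .q) := by
  refine mem_of_gen _ (fun g => ?_) u
  have adj_eq : ∀ a : U, adj (gen .q) a = -⁅a, gen .q⁆ := fun a => by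
    rw [adj_apply, LieRing.of_associative_ring_bracket, neg_sub]
  have R := rels
  cases g
  · exact ⟨1, by simp [adj_eq, R.fq]⟩
  · exact ⟨1, by simp [adj_eq]⟩
  · exact ⟨2, by simp [adj_eq, R.hq]⟩
  · exact ⟨1, by simp [adj_eq, R.zg]⟩
  · exact ⟨2, by simp [adj_eq, R.pq, R.zg]⟩
  · exact ⟨3, by simp [adj_eq, R.eq, R.pq, R.zg]⟩

noncomputable instance : OreLocalization.OreSet (Submonoid.powers (gen .q)) :=
  oreSetOfLocNil (gen .q) mem_locNil_q

end U

/-- The localization of `U` with respect to (the powers of) `q`. -/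
abbrev Uq : Type := OreLocalization (Submonoid.powers (U.gen .q)) U

namespace Uq

/-- The canonical homomorphism from `U` to its localization. -/
noncomputable def ofU : U →ₐ[ℂ] Uq :=
  { OreLocalization.numeratorRingHom with commutes' := fun _ => rfl }

theorem ofU_apply (u : U) : ofU u = OreLocalization.numeratorHom u := rfl

/-- The image in the localization of the basis element with label `g`. -/
noncomputable def gen (g : Gen) : Uq := ofU (U.gen g)

/-- The invertible element `q` of the localization. -/
noncomputable def qUnit : Uqˣ :=
  OreLocalization.numeratorUnit ⟨U.gen .q, Submonoid.mem_powers _⟩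

theorem qUnit_val : (qUnit : Uq) = gen .q := rfl

theorem rels : Rels gen := by
  obtain ⟨h1, h2, h3, h4, h5, h6, h7, h8, h9, h10, h11⟩ := U.rels
  have hl : ∀ a b, ⁅gen a, gen b⁆ = ofU ⁅U.gen a, U.gen b⁆ := fun a b => by
    simp only [LieRing.of_associative_ring_bracket, map_sub, map_mul, gen]
  constructor
  all_goals try intro g
  all_goals simp only [hl, h1, h2, h3, h4, h5, h6, h7, h8, h9, h10, h11, map_smul, map_neg,
    map_zero]
  all_goals rfl

/-- The algebra homomorphism out of the localization induced by a homomorphism out of `U` sending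
`q` to a unit. -/
noncomputable def lift {A : Type*} [Ring A] [Algebra ℂ A] (φ : U →ₐ[ℂ] A) (w : Aˣ)
    (H : φ (U.gen .q) = w) : Uq →ₐ[ℂ] A :=
  have hs : ∀ s : Submonoid.powers (U.gen .q), IsUnit (φ s) := by
    rintro ⟨_, m, rfl⟩
    exact ⟨w ^ m, by simp [H]⟩
  { OreLocalization.universalHom (φ : U →+* A)
      (IsUnit.liftRight ((φ : U →* A).comp (Submonoid.powers (U.gen .q)).subtype) hs)
      (fun _ => rfl) with
    commutes' := fun r => by
      have := OreLocalization.universalHom_commutes (φ : U →+* A)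
        (IsUnit.liftRight ((φ : U →* A).comp (Submonoid.powers (U.gen .q)).subtype) hs)
        (fun _ => rfl) (r := algebraMap ℂ U r)
      exact this.trans (φ.commutes r) }

theorem lift_ofU {A : Type*} [Ring A] [Algebra ℂ A] (φ : U →ₐ[ℂ] A) (w : Aˣ)
    (H : φ (U.gen .q) = w) (u : U) : lift φ w H (ofU u) = φ u :=
  OreLocalization.universalHom_commutes (φ : U →+* A) _ _

theorem hom_ext {A : Type*} [Ring A] [Algebra ℂ A] {φ ψ : Uq →ₐ[ℂ] A}
    (H : ∀ g, φ (gen g) = ψ (gen g)) : φ = ψ := by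
  have h1 : φ.comp ofU = ψ.comp ofU := U.hom_ext H
  have h2 : ∀ a : Uq, ∃ (s : Uqˣ) (u : U), (∃ t : U, ofU t = s) ∧ (s : Uq) * a = ofU u := by
    intro a
    induction a using OreLocalization.ind with
    | _ r s =>
      refine ⟨OreLocalization.numeratorUnit s, r, ⟨s, rfl⟩, ?_⟩
      exact OreLocalization.mul_cancel (r := r) (s := s) (t := 1)
  ext a
  obtain ⟨s, u, ⟨t, ht⟩, hu⟩ := h2 a
  have e1 : φ s * φ a = ψ s * ψ a := by
    rw [← map_mul, ← map_mul, hu]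
    exact DFunLike.congr_fun h1 u
  have e2 : φ s = ψ s := by rw [← ht]; exact DFunLike.congr_fun h1 t
  rw [e2] at e1
  exact (s.isUnit.map ψ).mul_left_cancel e1

end Uq

/-! ## The automorphisms `Θ_x` of the localization -/

/-- The values of `Θ_x` on the generators:
`f ↦ f`, `q ↦ q`, `h ↦ h - x`, `z ↦ z`, `p ↦ p + x q⁻¹ z`,
`e ↦ e + x q⁻¹ p + (1/2) x (x - 1) q⁻² z`. -/
noncomputable def thetaGen (x : ℂ) : Gen → Uq
  | .f => Uq.gen .f
  | .q => Uq.gen .q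
  | .h => Uq.gen .h - algebraMap ℂ Uq x
  | .z => Uq.gen .z
  | .p => Uq.gen .p + x • (↑(Uq.qUnit⁻¹) * Uq.gen .z)
  | .e => Uq.gen .e + x • (↑(Uq.qUnit⁻¹) * Uq.gen .p)
      + (1 / 2 * x * (x - 1)) • (↑(Uq.qUnit ^ (-2 : ℤ)) * Uq.gen .z)

theorem theta_aux {A : Type*} [Ring A] [Algebra ℂ A] (a : Gen → A) (R : Rels a) (y : A)
    (h1 : a .q * y = 1) (h2 : y * a .q = 1) (x : ℂ) (b : Gen → A)
    (bf : b .f = a .f) (bq : b .q = a .q) (bh : b .h = a .h - algebraMap ℂ A x) (bz : b .z = a .z)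
    (bp : b .p = a .p + x • (y * a .z))
    (be : b .e = a .e + x • (y * a .p) + (1 / 2 * x * (x - 1)) • (y * y * a .z)) :
    Rels b := by
  have conj : ∀ s t : A, ⁅s, a .q⁆ = t → s * y = y * s - y * t * y := by
    rintro s t rfl
    have e1 : y * (s * a .q - a .q * s) * y = y * s * (a .q * y) - (y * a .q) * s * y := by
      noncomm_ring
    rw [LieRing.of_associative_ring_bracket, e1, h1, h2, mul_one, one_mul, sub_sub_cancel]
  have zc : ∀ g, a .z * a g = a g * a .z := fun g => sub_eq_zero.mp (by
    rw [← LieRing.of_associative_ring_bracket, R.zg])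
  have mv : ∀ s t r : A, ⁅s, t⁆ = r → s * t = t * s + r := by
    rintro s t r rfl; rw [LieRing.of_associative_ring_bracket]; abel
  have fy := conj _ _ R.fq
  have hy := conj _ _ R.hq
  have zy := conj _ _ (R.zg .q)
  have py := conj _ _ R.pq
  have ey := conj _ _ R.eq
  have fq := mv _ _ _ R.fq
  have hq := mv _ _ _ R.hq
  have pq := mv _ _ _ R.pq
  have eq := mv _ _ _ R.eq
  have he := mv _ _ _ R.he
  have hp := mv _ _ _ R.hp
  have hf := mv _ _ _ R.hf
  have ep := mv _ _ _ R.ep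
  have ef := mv _ _ _ R.ef
  have pf := mv _ _ _ R.pf
  have as : ∀ {s t r : A}, s * t = r → ∀ w, s * (t * w) = r * w := by
    rintro s t r rfl w; rw [mul_assoc]
  have hy' : a .h * y = y * a .h + y := by
    rw [hy, mul_neg, neg_mul, sub_neg_eq_add, h2, one_mul]
  have fy' : a .f * y = y * a .f := by rw [fy, mul_zero, zero_mul, sub_zero]
  have zy' : a .z * y = y * a .z := by rw [zy, mul_zero, zero_mul, sub_zero]
  have py' : a .p * y = y * a .p - y * (y * a .z) := by rw [py, mul_assoc y (a .z), zy']
  have ey' : a .e * y = y * a .e - y * (y * a .p) + y * (y * (y * a .z)) := by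
    rw [ey, mul_assoc y (a .p), py']; noncomm_ring
  have zf := zc .f
  have zq := zc .q
  have zh := zc .h
  have zp := zc .p
  have ze := zc .e
  clear fy hy zy py ey
  constructor
  case zg =>
    intro g
    cases g
    all_goals
      rw [LieRing.of_associative_ring_bracket]
      simp only [bf, bq, bh, bz, bp, be, Algebra.algebraMap_eq_smul_one, mul_add, add_mul, mul_sub, sub_mul,
        mul_smul_comm, smul_mul_assoc, mul_assoc, mul_one, one_mul, zf, zq, zh, zp, ze, zy', as zf,
        as zq, as zh, as zp, as ze, as zy']
      module
  all_goals
    rw [LieRing.of_associative_ring_bracket]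
    simp only [bf, bq, bh, bz, bp, be, Algebra.algebraMap_eq_smul_one, mul_add, add_mul, mul_sub, sub_mul,
      mul_smul_comm, smul_mul_assoc, mul_assoc, mul_one, one_mul, mul_zero, zero_mul,
      neg_mul, mul_neg, zf, zq, zh, zp, ze, zy', as zf,
      as zq, as zh, as zp, as ze, as zy', h1, h2, as h1, as h2, fy', as fy', hy', as hy',
      py', as py', ey', as ey', fq, as fq, hq, as hq, pq, as pq, eq, as eq, he, as he, hp, as hp,
      hf, as hf, ep, as ep, ef, as ef, pf, as pf]
    module

theorem thetaGen_rels (x : ℂ) : Rels (thetaGen x) :=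
  theta_aux Uq.gen Uq.rels (↑(Uq.qUnit⁻¹)) (Units.mul_inv Uq.qUnit) (Units.inv_mul Uq.qUnit) x
    (thetaGen x) rfl rfl rfl rfl rfl (by
      have : ((Uq.qUnit ^ (-2 : ℤ) : Uqˣ) : Uq) = ↑(Uq.qUnit⁻¹) * ↑(Uq.qUnit⁻¹) := by
        rw [← Units.val_mul]; congr 1; group
      rw [← this]; rfl)

/-- `Θ_x` as an endomorphism of the localization. -/
noncomputable def thetaHom (x : ℂ) : Uq →ₐ[ℂ] Uq :=
  Uq.lift (U.lift (thetaGen x) (thetaGen_rels x)) Uq.qUnit (U.lift_gen _ _ _)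

theorem thetaHom_gen (x : ℂ) (g : Gen) : thetaHom x (Uq.gen g) = thetaGen x g :=
  (Uq.lift_ofU _ _ _ _).trans (U.lift_gen _ _ _)

theorem thetaHom_qUnit (x : ℂ) : Units.map (thetaHom x : Uq →* Uq) Uq.qUnit = Uq.qUnit :=
  Units.ext (thetaHom_gen x .q)

theorem thetaHom_qUnit_zpow (x : ℂ) (i : ℤ) :
    thetaHom x ((Uq.qUnit ^ i : Uqˣ) : Uq) = ((Uq.qUnit ^ i : Uqˣ) : Uq) := by
  have := congrArg (fun w : Uqˣ => ((w ^ i : Uqˣ) : Uq)) (thetaHom_qUnit x)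
  simp only [← map_zpow] at this
  exact this

theorem thetaHom_qUnit_inv (x : ℂ) :
    thetaHom x ((Uq.qUnit⁻¹ : Uqˣ) : Uq) = ((Uq.qUnit⁻¹ : Uqˣ) : Uq) := by
  have := thetaHom_qUnit_zpow x (-1)
  rwa [zpow_neg_one] at this

theorem thetaHom_comp (x y : ℂ) : (thetaHom x).comp (thetaHom y) = thetaHom (x + y) := by
  have hw : ((Uq.qUnit ^ (-2 : ℤ) : Uqˣ) : Uq) = ↑(Uq.qUnit⁻¹) * ↑(Uq.qUnit⁻¹) := by
    rw [← Units.val_mul]; congr 1; group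
  apply Uq.hom_ext
  intro g
  rw [AlgHom.comp_apply, thetaHom_gen, thetaHom_gen]
  cases g <;>
    simp only [thetaGen, map_add, map_sub, map_smul, map_mul, thetaHom_gen, thetaHom_qUnit_inv,
      thetaHom_qUnit_zpow, AlgHom.commutes, Algebra.algebraMap_eq_smul_one, mul_add,
      mul_smul_comm, hw, mul_assoc, map_one]
  all_goals module

theorem thetaHom_zero : thetaHom 0 = AlgHom.id ℂ Uq := by
  apply Uq.hom_ext
  intro g
  rw [thetaHom_gen]
  cases g <;> simp [thetaGen]

/-- The automorphism `Θ_x` of the localization of `U` with respect to `q`. -/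
noncomputable def theta (x : ℂ) : Uq ≃ₐ[ℂ] Uq :=
  AlgEquiv.ofAlgHom (thetaHom x) (thetaHom (-x))
    (by rw [thetaHom_comp, add_neg_cancel, thetaHom_zero])
    (by rw [thetaHom_comp, neg_add_cancel, thetaHom_zero])

theorem theta_gen (x : ℂ) (g : Gen) : theta x (Uq.gen g) = thetaGen x g := thetaHom_gen x g

/-! ## The twisting functor (on objects) -/

section Twist

open scoped TensorProduct

variable (x : ℂ) (V : Type*) [AddCommGroup V] [Module ℂ V] [Module U V] [IsScalarTower ℂ U V]

/-- The relations `a u ⊗ v = a ⊗ u v` for `u` in `U`, which turn the tensor product over `ℂ` into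
the tensor product over `U`. -/
noncomputable def tensorRel : Submodule Uq (Uq ⊗[ℂ] V) :=
  Submodule.span Uq {t | ∃ (a : Uq) (u : U) (v : V), t = (a * Uq.ofU u) ⊗ₜ[ℂ] v - a ⊗ₜ[ℂ] (u • v)}

/-- The induced module: the tensor product over `U` of the localization of `U` with `V`. The set of
relations is stable under left multiplication, so that the submodule they span is the additive
subgroup which they generate. -/
abbrev Ind : Type _ := (Uq ⊗[ℂ] V) ⧸ tensorRel V

/-- The twisting functor `B_x` with respect to `q` on objects: the induced module, on which an
element `u` of `U` acts as `Θ_x(u)`. -/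
def Twist (_x : ℂ) (V : Type*) [AddCommGroup V] [Module ℂ V] [Module U V]
    [IsScalarTower ℂ U V] : Type _ := Ind V

noncomputable instance : AddCommGroup (Twist x V) := inferInstanceAs (AddCommGroup (Ind V))

noncomputable instance : Module ℂ (Twist x V) := inferInstanceAs (Module ℂ (Ind V))

noncomputable instance : Module U (Twist x V) :=
  Module.compHom (Ind V) (((theta x : Uq →ₐ[ℂ] Uq).comp Uq.ofU : U →ₐ[ℂ] Uq) : U →+* Uq)

instance : IsScalarTower ℂ U (Twist x V) where
  smul_assoc r u w := by
    change theta x (Uq.ofU (r • u)) • (show Ind V from w) =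
      r • (theta x (Uq.ofU u) • (show Ind V from w))
    rw [map_smul, map_smul, smul_assoc]

/-- The pure tensor `a ⊗ v`, as an element of the twisted module. -/
noncomputable def Twist.tmul (x : ℂ) {V : Type*} [AddCommGroup V] [Module ℂ V] [Module U V] [IsScalarTower ℂ U V]
    (a : Uq) (v : V) : Twist x V :=
  (Submodule.Quotient.mk (a ⊗ₜ[ℂ] v) : Ind V)

theorem Twist.smul_tmul {V : Type*} [AddCommGroup V] [Module ℂ V] [Module U V]
    [IsScalarTower ℂ U V] (u : U) (a : Uq) (v : V) :
    u • Twist.tmul x a v = Twist.tmul x (theta x (Uq.ofU u) * a) v := rfl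

theorem Twist.tmul_smul {V : Type*} [AddCommGroup V] [Module ℂ V] [Module U V]
    [IsScalarTower ℂ U V] (u : U) (a : Uq) (v : V) :
    Twist.tmul x (a * Uq.ofU u) v = Twist.tmul x a (u • v) :=
  (Submodule.Quotient.eq _).mpr (Submodule.subset_span ⟨a, u, v, rfl⟩)

end Twist

/-! ## Weights -/

section Weights

variable {V : Type*} [AddCommGroup V] [Module ℂ V] [Module U V]

/-- The set of weights of `V`: the eigenvalues of `h`. -/
def supp (V : Type*) [AddCommGroup V] [Module ℂ V] [Module U V] : Set ℂ :=
  {μ | ∃ v : V, v ≠ 0 ∧ U.gen .h • v = μ • v}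

/-- `μ` is a highest weight of `V`: a weight that is maximal for the order in which `μ ≤ ν` if and
only if `ν - μ` is a nonnegative integer. -/
def IsHighestWeight (V : Type*) [AddCommGroup V] [Module ℂ V] [Module U V] (μ : ℂ) : Prop :=
  μ ∈ supp V ∧ ∀ ν ∈ supp V, (∃ k : ℕ, ν - μ = k) → ν = μ

/-- A highest weight vector: a nonzero vector whose weight is a highest weight. -/
def IsHighestWeightVector (v : V) : Prop :=
  v ≠ 0 ∧ ∃ μ : ℂ, IsHighestWeight V μ ∧ U.gen .h • v = μ • v

end Weights

/-! ## The simple highest weight modules `N(λ, c)` -/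

/-- The underlying vector space of `N(λ, c)`, where `λ = -1/2 + n`: it has basis `v_{i,j}` with
`i`, `j` natural numbers and `j ≤ λ + 1/2 = n`. -/
def N (n : ℕ) (_c : ℂˣ) : Type := (ℕ × Fin (n + 1)) →₀ ℂ

namespace N

variable (n : ℕ) (c : ℂˣ)

noncomputable instance : AddCommGroup (N n c) :=
  inferInstanceAs (AddCommGroup ((ℕ × Fin (n + 1)) →₀ ℂ))
noncomputable instance : Module ℂ (N n c) :=
  inferInstanceAs (Module ℂ ((ℕ × Fin (n + 1)) →₀ ℂ))

/-- The basis of `N(λ, c)`. -/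
noncomputable def basis : Module.Basis (ℕ × Fin (n + 1)) ℂ (N n c) := Finsupp.basisSingleOne

/-- The basis vector `v_{i,j}` (zero if `j` is out of range). -/
noncomputable def vec (i j : ℕ) : N n c :=
  if hj : j < n + 1 then basis n c (i, ⟨j, hj⟩) else 0

/-- The value of `f v_{i,n}`, where `n = λ + 1/2`:
`-∑_{s=0}^{λ+1/2} (2c)^{-(λ+3/2-s)} binom(λ+3/2, s) v_{i+2λ+3-2s,s}`. -/
noncomputable def top (i : ℕ) : N n c :=
  -∑ s ∈ Finset.range (n + 1),
    (1 / (2 * (c : ℂ)) ^ (n + 1 - s) * ((n + 1).choose s : ℂ)) • vec n c (i + 2 * (n + 1 - s)) s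

/-- The action of the generators on `v_{i,j}`, where `λ = -1/2 + n`. The terms in which a truncated
subtraction is not the true one have coefficient zero. -/
noncomputable def actVec (i j : ℕ) : Gen → N n c
  | .q => vec n c (i + 1) j
  | .f => if j < n then vec n c i (j + 1) else top n c i
  | .z => (c : ℂ) • vec n c i j
  | .h => ((-1 / 2 + n : ℂ) - i - 2 * j) • vec n c i j
  | .p => -(j : ℂ) • vec n c (i + 1) (j - 1) + ((c : ℂ) * i) • vec n c (i - 1) j
  | .e => ((j : ℂ) * ((-1 / 2 + n : ℂ) + 1 - i - j)) • vec n c i (j - 1)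
      + (1 / 2 * (c : ℂ) * i * (i - 1)) • vec n c (i - 2) j

/-- The linear operators by which the generators act. -/
noncomputable def act (g : Gen) : Module.End ℂ (N n c) :=
  (basis n c).constr ℂ fun ij => actVec n c ij.1 ij.2 g

variable {n}

theorem act_vec (g : Gen) (i j : ℕ) (hj : j ≤ n) : act n c g (vec n c i j) = actVec n c i j g := by
  have hj' : j < n + 1 := by omega
  rw [vec, dif_pos hj', act, Module.Basis.constr_basis]

theorem act_top_q (i : ℕ) : act n c .q (top n c i) = top n c (i + 1) := by
  simp only [top, map_neg, map_sum, map_smul]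
  congr 1
  refine Finset.sum_congr rfl fun s hs => ?_
  have hs' : s ≤ n := by have := Finset.mem_range.mp hs; omega
  rw [act_vec c _ _ _ hs']
  simp only [actVec]
  congr 2
  omega

theorem act_top_z (i : ℕ) : act n c .z (top n c i) = (c : ℂ) • top n c i := by
  simp only [top, map_neg, map_sum, map_smul, smul_neg, Finset.smul_sum]
  congr 1
  refine Finset.sum_congr rfl fun s hs => ?_
  have hs' : s ≤ n := by have := Finset.mem_range.mp hs; omega
  rw [act_vec c _ _ _ hs']
  simp only [actVec]
  module

theorem act_top_h (i : ℕ) :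
    act n c .h (top n c i) = ((-1 / 2 + n : ℂ) - i - 2 * (n + 1)) • top n c i := by
  simp only [top, map_neg, map_sum, map_smul, smul_neg, Finset.smul_sum]
  congr 1
  refine Finset.sum_congr rfl fun s hs => ?_
  have hs' : s ≤ n := by have := Finset.mem_range.mp hs; omega
  rw [act_vec c _ _ _ hs']
  simp only [actVec]
  push_cast [Nat.cast_sub (show s ≤ n + 1 by omega)]
  module

/-- The coefficients in `top`. -/
noncomputable def co (n : ℕ) (c : ℂˣ) (s : ℕ) : ℂ :=
  1 / (2 * (c : ℂ)) ^ (n + 1 - s) * ((n + 1).choose s : ℂ)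

theorem co_succ (s : ℕ) (hs : s ≤ n) :
    ((s : ℂ) + 1) * co n c (s + 1) = 2 * c * ((n : ℂ) + 1 - s) * co n c s := by
  obtain ⟨k, rfl⟩ := Nat.exists_eq_add_of_le hs
  have h1 : s + k + 1 - s = k + 1 := by omega
  have h2 : s + k + 1 - (s + 1) = k := by omega
  have h3 : ((s + k + 1).choose (s + 1) : ℂ) * (s + 1) = ((s + k + 1).choose s : ℂ) * (k + 1) := by
    have := Nat.choose_succ_right_eq (s + k + 1) s
    rw [h1] at this
    exact_mod_cast this
  have hc : (c : ℂ) ≠ 0 := c.ne_zero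
  rw [co, co, h1, h2, pow_succ]
  push_cast
  field_simp
  linear_combination h3

theorem co_last : co n c (n + 1) = 1 := by simp [co]

theorem sum_shift (F : ℕ → N n c) (G : ℕ → ℂ) :
    ∑ s ∈ Finset.range (n + 1), ((s : ℂ) * G s) • F (s - 1)
      = ∑ s ∈ Finset.range n, (((s : ℂ) + 1) * G (s + 1)) • F s := by
  rw [Finset.sum_range_succ']
  simp

theorem act_top_p (i : ℕ) : act n c .p (top n c i) =
    -((n : ℂ) + 1) • vec n c (i + 1) n + ((c : ℂ) * i) • top n c (i - 1) := by
  have e1 : act n c .p (top n c i) =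
      ∑ s ∈ Finset.range (n + 1), ((s : ℂ) * co n c s) •
        (fun t => vec n c (i + 2 * (n + 1 - t) - 1) t) (s - 1)
      - ∑ s ∈ Finset.range (n + 1), (co n c s * (c * (i + 2 * ((n : ℂ) + 1 - s)))) •
          vec n c (i + 2 * (n + 1 - s) - 1) s := by
    simp only [top, map_neg, map_sum, map_smul]
    rw [← Finset.sum_sub_distrib, ← Finset.sum_neg_distrib]
    refine Finset.sum_congr rfl fun s hs => ?_
    have hs' : s ≤ n := by have := Finset.mem_range.mp hs; omega
    rw [act_vec c _ _ _ hs', ← co]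
    simp only [actVec]
    rcases s with _ | s
    · push_cast [Nat.cast_sub (show 0 ≤ n + 1 by omega)]
      module
    · have : i + 2 * (n + 1 - (s + 1)) + 1 = i + 2 * (n + 1 - s) - 1 := by omega
      simp only [Nat.add_sub_cancel]
      have hc : ((n - s : ℕ) : ℂ) = (n : ℂ) - s := Nat.cast_sub (by omega)
      rw [this]
      push_cast [Nat.add_sub_add_right, hc]
      module
  have e2 : ((c : ℂ) * i) • top n c (i - 1) = -∑ s ∈ Finset.range (n + 1),
      (co n c s * (c * i)) • vec n c (i + 2 * (n + 1 - s) - 1) s := by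
    simp only [top, smul_neg, Finset.smul_sum]
    congr 1
    refine Finset.sum_congr rfl fun s hs => ?_
    rw [← co]
    rcases i with _ | i
    · simp
    · have : i + 1 - 1 + 2 * (n + 1 - s) = i + 1 + 2 * (n + 1 - s) - 1 := by omega
      rw [this]
      module
  rw [e1, e2, sum_shift c (fun t => vec n c (i + 2 * (n + 1 - t) - 1) t), Finset.sum_range_succ _ n,
    Finset.sum_range_succ _ n]
  have e3 : ∑ s ∈ Finset.range n, (((s : ℂ) + 1) * co n c (s + 1)) •
        vec n c (i + 2 * (n + 1 - s) - 1) s =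
      ∑ s ∈ Finset.range n, (co n c s * (c * (i + 2 * ((n : ℂ) + 1 - s)))) •
          vec n c (i + 2 * (n + 1 - s) - 1) s -
      ∑ s ∈ Finset.range n, (co n c s * (c * i)) • vec n c (i + 2 * (n + 1 - s) - 1) s := by
    rw [← Finset.sum_sub_distrib]
    refine Finset.sum_congr rfl fun s hs => ?_
    have hs' : s ≤ n := by have := Finset.mem_range.mp hs; omega
    rw [co_succ c s hs', ← sub_smul]
    congr 1
    ring
  have e4 := co_succ c n le_rfl
  rw [co_last] at e4
  have e5 : i + 2 * (n + 1 - n) - 1 = i + 1 := by omega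
  rw [e3, e5]
  match_scalars
  all_goals first | ring1 | linear_combination e4

theorem act_top_e (i : ℕ) : act n c .e (top n c i) =
    (((n : ℂ) + 1) * ((-1 / 2 + n : ℂ) + 1 - i - (n + 1))) • vec n c i n
      + (1 / 2 * (c : ℂ) * i * (i - 1)) • top n c (i - 2) := by
  have e1 : act n c .e (top n c i) =
      -∑ s ∈ Finset.range (n + 1), ((s : ℂ) * (co n c s *
          ((-1 / 2 + n : ℂ) + 1 - (i + 2 * ((n : ℂ) + 1 - s)) - s))) •
        (fun t => vec n c (i + 2 * (n + 1 - t) - 2) t) (s - 1)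
      - ∑ s ∈ Finset.range (n + 1), (co n c s * (1 / 2 * (c * (i + 2 * ((n : ℂ) + 1 - s)) *
          (i + 2 * ((n : ℂ) + 1 - s) - 1)))) •
          vec n c (i + 2 * (n + 1 - s) - 2) s := by
    simp only [top, map_neg, map_sum, map_smul]
    rw [sub_eq_add_neg, ← neg_add, ← Finset.sum_add_distrib]
    congr 1
    refine Finset.sum_congr rfl fun s hs => ?_
    have hs' : s ≤ n := by have := Finset.mem_range.mp hs; omega
    rw [act_vec c _ _ _ hs', ← co]
    simp only [actVec]
    rcases s with _ | s
    · push_cast [Nat.cast_sub (show 0 ≤ n + 1 by omega)]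
      module
    · have : i + 2 * (n + 1 - (s + 1)) = i + 2 * (n + 1 - s) - 2 := by omega
      have hc : ((n - s : ℕ) : ℂ) = (n : ℂ) - s := Nat.cast_sub (by omega)
      simp only [Nat.add_sub_cancel]
      rw [← this]
      push_cast [Nat.add_sub_add_right, hc]
      module
  have e2 : (1 / 2 * (c : ℂ) * i * (i - 1)) • top n c (i - 2) = -∑ s ∈ Finset.range (n + 1),
      (co n c s * (1 / 2 * c * i * (i - 1))) • vec n c (i + 2 * (n + 1 - s) - 2) s := by
    simp only [top, smul_neg, Finset.smul_sum]
    congr 1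
    refine Finset.sum_congr rfl fun s hs => ?_
    rw [← co]
    rcases i with _ | _ | i
    · simp
    · simp
    · have : i + 1 + 1 - 2 + 2 * (n + 1 - s) = i + 1 + 1 + 2 * (n + 1 - s) - 2 := by omega
      rw [this]
      module
  rw [e1, e2, sum_shift c (fun t => vec n c (i + 2 * (n + 1 - t) - 2) t), Finset.sum_range_succ _ n,
    Finset.sum_range_succ _ n]
  have e3 : ∑ s ∈ Finset.range n, (((s : ℂ) + 1) * (co n c (s + 1) *
          ((-1 / 2 + n : ℂ) + 1 - (i + 2 * ((n : ℂ) + 1 - (s + 1 : ℕ))) - (s + 1 : ℕ)))) •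
        vec n c (i + 2 * (n + 1 - s) - 2) s =
      ∑ s ∈ Finset.range n, (co n c s * (1 / 2 * c * i * (i - 1))) •
          vec n c (i + 2 * (n + 1 - s) - 2) s -
      ∑ s ∈ Finset.range n, (co n c s * (1 / 2 * (c * (i + 2 * ((n : ℂ) + 1 - s)) *
          (i + 2 * ((n : ℂ) + 1 - s) - 1)))) • vec n c (i + 2 * (n + 1 - s) - 2) s := by
    rw [← Finset.sum_sub_distrib]
    refine Finset.sum_congr rfl fun s hs => ?_
    have hs' : s ≤ n := by have := Finset.mem_range.mp hs; omega
    rw [← mul_assoc, co_succ c s hs', ← sub_smul]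
    congr 1
    push_cast
    ring
  have e4 := co_succ c n le_rfl
  rw [co_last] at e4
  have e5 : i + 2 * (n + 1 - n) - 2 = i := by omega
  rw [e3, e5]
  match_scalars
  all_goals first | ring1 | linear_combination (i + 1 / 2 : ℂ) * e4

theorem actRels : Rels (A := Module.End ℂ (N n c)) (act n c) := by
  have hb : ∀ φ ψ : Module.End ℂ (N n c),
      (∀ i j, j ≤ n → φ (vec n c i j) = ψ (vec n c i j)) → φ = ψ := by
    intro φ ψ H
    refine (basis n c).ext fun ij => ?_
    obtain ⟨i, j, hj⟩ := ij
    have := H i j (by omega)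
    rwa [vec, dif_pos hj] at this
  have vq : ∀ i j, j ≤ n → act n c .q (vec n c i j) = vec n c (i + 1) j :=
    fun i j hj => act_vec c .q i j hj
  have vz : ∀ i j, j ≤ n → act n c .z (vec n c i j) = (c : ℂ) • vec n c i j :=
    fun i j hj => act_vec c .z i j hj
  have vh : ∀ i j, j ≤ n → act n c .h (vec n c i j) =
      ((-1 / 2 + n : ℂ) - i - 2 * j) • vec n c i j := fun i j hj => act_vec c .h i j hj
  have vp : ∀ i j, j ≤ n → act n c .p (vec n c i j) =
      -(j : ℂ) • vec n c (i + 1) (j - 1) + ((c : ℂ) * i) • vec n c (i - 1) j :=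
    fun i j hj => act_vec c .p i j hj
  have ve : ∀ i j, j ≤ n → act n c .e (vec n c i j) =
      ((j : ℂ) * ((-1 / 2 + n : ℂ) + 1 - i - j)) • vec n c i (j - 1)
      + (1 / 2 * (c : ℂ) * i * (i - 1)) • vec n c (i - 2) j := fun i j hj => act_vec c .e i j hj
  have vf : ∀ i j, j < n → act n c .f (vec n c i j) = vec n c i (j + 1) := fun i j hj => by
    rw [act_vec c .f i j hj.le]; exact if_pos hj
  have vt : ∀ i, act n c .f (vec n c i n) = top n c i := fun i => by
    rw [act_vec c .f i n le_rfl]; exact if_neg (lt_irrefl n)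
  have tq : ∀ i, act n c .q (top n c i) = top n c (i + 1) := act_top_q c
  have tz : ∀ i, act n c .z (top n c i) = (c : ℂ) • top n c i := act_top_z c
  have th := act_top_h (n := n) c
  have tp := act_top_p (n := n) c
  have te := act_top_e (n := n) c
  have br : ∀ (φ ψ : Module.End ℂ (N n c)) (w : N n c), ⁅φ, ψ⁆ w = φ (ψ w) - ψ (φ w) :=
    fun φ ψ w => rfl
  -- brackets with `f`, separately below and at the top
  have hbf : ∀ φ ψ : Module.End ℂ (N n c), (∀ i j, j < n → φ (vec n c i j) = ψ (vec n c i j)) →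
      (∀ i, φ (vec n c i n) = ψ (vec n c i n)) → φ = ψ := fun φ ψ H1 H2 =>
    hb φ ψ fun i j hj => (lt_or_eq_of_le hj).elim (H1 i j) (fun h => h ▸ H2 i)
  constructor
  case hf =>
    refine hbf _ _ (fun i j hj => ?_) (fun i => ?_)
    · rw [br, vf i j hj, vh i (j + 1) hj, vh i j hj.le, map_smul, LinearMap.smul_apply, vf i j hj]
      push_cast
      module
    · rw [br, vt, th, vh i n le_rfl, map_smul, LinearMap.smul_apply, vt]
      module
  case ef =>
    refine hbf _ _ (fun i j hj => ?_) (fun i => ?_)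
    · rw [br, vf i j hj, ve i (j + 1) hj, ve i j hj.le, vh i j hj.le, map_add, map_smul, map_smul,
        vf (i - 2) j hj]
      rcases j with _ | j
      · push_cast
        module
      · rw [Nat.add_sub_cancel, Nat.add_sub_cancel, vf i j (by omega)]
        push_cast
        module
    · rw [br, vt, te, ve i n le_rfl, vh i n le_rfl, map_add, map_smul, map_smul, vt]
      rcases n with _ | n
      · push_cast
        module
      · rw [Nat.add_sub_cancel, vf i n (by omega)]
        push_cast
        module
  case pf =>
    refine hbf _ _ (fun i j hj => ?_) (fun i => ?_)
    · rw [br, vf i j hj, vp i (j + 1) hj, vp i j hj.le, LinearMap.neg_apply, vq i j hj.le,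
        map_add, map_smul, map_smul, vf (i - 1) j hj]
      rcases j with _ | j
      · push_cast
        module
      · rw [Nat.add_sub_cancel, Nat.add_sub_cancel, vf (i + 1) j (by omega)]
        push_cast
        module
    · rw [br, vt, tp, vp i n le_rfl, LinearMap.neg_apply, vq i n le_rfl, map_add, map_smul,
        map_smul, vt]
      rcases n with _ | n
      · push_cast
        module
      · rw [Nat.add_sub_cancel, vf (i + 1) n (by omega)]
        push_cast
        module
  case fq =>
    refine hbf _ _ (fun i j hj => ?_) (fun i => ?_)
    · rw [br, vf i j hj, vq i (j + 1) hj, vq i j hj.le, vf (i + 1) j hj]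
      simp
    · rw [br, vt, tq, vq i n le_rfl, vt]
      simp
  case zg =>
    intro g
    cases g
    case f =>
      refine hbf _ _ (fun i j hj => ?_) (fun i => ?_)
      · rw [br, vf i j hj, vz i (j + 1) hj, vz i j hj.le, map_smul, vf i j hj]
        simp
      · rw [br, vt, tz, vz i n le_rfl, map_smul, vt]
        simp
    all_goals
      refine hb _ _ fun i j hj => ?_
      have hj1 : j - 1 ≤ n := by omega
      simp only [br, vq _ _ hj, vz _ _ hj, vh _ _ hj, vp _ _ hj, ve _ _ hj, vz _ _ hj1,
        map_add, map_smul, LinearMap.zero_apply]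
      module
  all_goals
    refine hb _ _ fun i j hj => ?_
    have hj1 : j - 1 ≤ n := by omega
    have hj2 : j - 1 - 1 ≤ n := by omega
    simp only [br, vq _ _ hj, vz _ _ hj, vh _ _ hj, vp _ _ hj, ve _ _ hj, vq _ _ hj1, vz _ _ hj1,
      vh _ _ hj1, vp _ _ hj1, ve _ _ hj1, map_add, map_smul, LinearMap.zero_apply,
      LinearMap.smul_apply, LinearMap.neg_apply]
    rcases i with _ | _ | _ | i <;> rcases j with _ | j <;>
      simp only [Nat.add_sub_cancel, Nat.zero_sub, Nat.sub_self, Nat.add_assoc, Nat.reduceAdd,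
        Nat.reduceSub, Nat.add_sub_add_right, Nat.zero_add, Nat.add_sub_cancel_right] <;>
      push_cast <;> module

variable (n)

noncomputable instance : Module U (N n c) :=
  Module.compHom (N n c) ((U.lift (act n c) (actRels c) : U →ₐ[ℂ] Module.End ℂ (N n c)) :
    U →+* Module.End ℂ (N n c))

instance : IsScalarTower ℂ U (N n c) where
  smul_assoc r u w := by
    change U.lift (act n c) (actRels c) (r • u) w = r • U.lift (act n c) (actRels c) u w
    rw [map_smul, LinearMap.smul_apply]

/-- The generators act on the basis by the prescribed formulas. -/
theorem gen_smul_vec (g : Gen) (i j : ℕ) (hj : j ≤ n) :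
    U.gen g • vec n c i j = actVec n c i j g := by
  change U.lift (act n c) (actRels c) (U.gen g) (vec n c i j) = _
  rw [U.lift_gen, act_vec c g i j hj]

end N

/-! ## The vectors `v_{i,j}` of the twisted module -/

/-- The vector `v_{i,j} = q^i f^j ⊗ v` of the twisted module, for an integer `i` and a natural
number `j`. -/
noncomputable def twistVec (x : ℂ) {V : Type*} [AddCommGroup V] [Module ℂ V] [Module U V]
    [IsScalarTower ℂ U V] (v : V) (i : ℤ) (j : ℕ) : Twist x V :=
  Twist.tmul x (((Uq.qUnit ^ i : Uqˣ) : Uq) * Uq.gen .f ^ j) v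

end Schrodinger

open Schrodinger

namespace Schrodinger
attribute [local instance 100] LieRing.ofAssociativeRing

/-! ## Conjugation by powers of `q` -/

namespace Uq

/-! The key identity is a q^i = q^i Θ_i(a) in the localization: for an integer i, the automorphism
Θ_i is conjugation by q^i (`Uq.mul_qUnit_zpow`). Since Θ_i Θ_x = Θ_{x+i}, an element u acts on q^i ⊗
w in the twisted module as q^i Θ_{x+i}(u) ⊗ w (`Twist.smul_zpow_tmul`). This is why i and x enter
the coefficients only through i + x. What remains is to apply the explicit value of Θ_{x+i} on a
generator to a vector v_{0,j} of N(λ, c) and to absorb powers of q into the left factor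
(`smul_twistVec`, `tmul_vec`).

For the basis, every element of the localization is a fraction q^m u, and q^m ⊗ v_{k,j} is one of
the proposed vectors, so these span (`span_twistVec`). For independence, a finite linear relation is
multiplied by a large power of q until all exponents are nonnegative; it then reads 1 ⊗ w = 0, with
w a combination of distinct basis vectors of N(λ, c). As q acts injectively on N(λ, c), the map w ↦
1 ⊗ w is injective (`Twist.eq_zero_of_tmul_one`), so w = 0.

Finally, h is diagonal on N(λ, c) with eigenvalues λ - i - 2j, so a highest weight vector is a
nonzero multiple of v_{0,0} (`N.eq_smul_of_isHighestWeightVector`). All assertions are compatible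
with rescaling v. -/

theorem gen_mul_qUnit (g : Gen) : gen g * qUnit = qUnit * thetaHom 1 (gen g) := by
  have mv : ∀ s t r : Uq, ⁅s, t⁆ = r → s * t = t * s + r := by
    rintro s t r rfl; rw [LieRing.of_associative_ring_bracket]; abel
  have R := rels
  rw [thetaHom_gen]
  cases g
  · simpa [thetaGen, qUnit_val] using mv _ _ _ R.fq
  · rfl
  · simpa [thetaGen, qUnit_val, mul_add, sub_eq_add_neg] using mv _ _ _ R.hq
  · simpa [thetaGen, qUnit_val] using mv _ _ _ (R.zg .q)
  · simpa [thetaGen, mul_add, ← qUnit_val] using mv _ _ _ R.pq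
  -- The factor x(x - 1) vanishes at x = 1, so q Θ_1(e) is just q e + p.
  · simpa [thetaGen, mul_add, ← qUnit_val] using mv _ _ _ R.eq

/-- Conjugation a ↦ q⁻¹ a q is an algebra endomorphism agreeing with Θ_1 on the generators, and
homomorphisms out of the localization are determined there. -/
theorem mul_qUnit (a : Uq) : a * qUnit = qUnit * thetaHom 1 a := by
  have H : MulSemiringAction.toAlgHom ℂ Uq (ConjAct.toConjAct qUnit⁻¹) = thetaHom 1 :=
    hom_ext fun g => by
      rw [MulSemiringAction.toAlgHom_apply, ConjAct.units_smul_def, ConjAct.ofConjAct_toConjAct,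
        inv_inv, mul_assoc, gen_mul_qUnit, Units.inv_mul_cancel_left]
  rw [← H, MulSemiringAction.toAlgHom_apply, ConjAct.units_smul_def, ConjAct.ofConjAct_toConjAct,
    inv_inv, mul_assoc, Units.mul_inv_cancel_left]

theorem thetaHom_thetaHom (x y : ℂ) (a : Uq) : thetaHom x (thetaHom y a) = thetaHom (x + y) a :=
  DFunLike.congr_fun (thetaHom_comp x y) a

theorem mul_qUnit_inv (a : Uq) : a * ↑qUnit⁻¹ = ↑qUnit⁻¹ * thetaHom (-1) a := by
  rw [Units.eq_inv_mul_iff_mul_eq, ← mul_assoc, Units.mul_inv_eq_iff_eq_mul, mul_qUnit,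
    thetaHom_thetaHom, add_neg_cancel, thetaHom_zero, AlgHom.id_apply]

/-- Conjugation by `q ^ i` is the automorphism `Θ_i`. -/
theorem mul_qUnit_zpow (a : Uq) (i : ℤ) :
    a * ↑(qUnit ^ i) = ↑(qUnit ^ i) * thetaHom i a := by
  induction i using Int.induction_on with
  | zero => simp [thetaHom_zero]
  | succ k ih =>
    rw [zpow_add_one, Units.val_mul, ← mul_assoc, ih, mul_assoc, mul_qUnit, thetaHom_thetaHom,
      ← mul_assoc]
    push_cast
    rw [add_comm]
  | pred k ih =>
    rw [zpow_sub_one, Units.val_mul, ← mul_assoc, ih, mul_assoc, mul_qUnit_inv, thetaHom_thetaHom,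
      ← mul_assoc]
    push_cast
    rw [sub_eq_neg_add]

theorem qUnit_pow (k : ℕ) : ((qUnit ^ (k : ℤ) : Uqˣ) : Uq) = ofU (U.gen .q ^ k) := by
  rw [zpow_natCast, Units.val_pow_eq_pow_val, map_pow]; rfl

/-- Every element of the localization is a left fraction `q⁻ᵐ u`. -/
theorem exists_eq_zpow_mul (a : Uq) : ∃ (m : ℤ) (u : U), a = ↑(qUnit ^ m) * ofU u := by
  induction a using OreLocalization.ind with
  | _ r s =>
    obtain ⟨_, m, rfl⟩ := s
    refine ⟨-m, r, ?_⟩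
    rw [zpow_neg, ← Units.inv_mul_eq_iff_eq_mul, inv_inv, qUnit_pow]
    -- With t = 1 this is the cancellation s · (s⁻¹ r) = r for s = q^m.
    exact OreLocalization.mul_cancel (r := r) 
      (s := (⟨U.gen .q ^ m, m, rfl⟩ : Submonoid.powers (U.gen .q))) (t := 1)

end Uq

/-! ## Pure tensors in the twisted module -/

namespace Twist

open scoped TensorProduct

variable (x : ℂ) {V : Type*} [AddCommGroup V] [Module ℂ V] [Module U V] [IsScalarTower ℂ U V]

theorem tmul_add (a : Uq) (v w : V) : tmul x a (v + w) = tmul x a v + tmul x a w := by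
  unfold tmul; rw [TensorProduct.tmul_add]; rfl

theorem add_tmul (a b : Uq) (v : V) : tmul x (a + b) v = tmul x a v + tmul x b v := by
  unfold tmul; rw [TensorProduct.add_tmul]; rfl

theorem smul_tmul_left (r : ℂ) (a : Uq) (v : V) : tmul x (r • a) v = r • tmul x a v := rfl

theorem tmul_smul_right (r : ℂ) (a : Uq) (v : V) : tmul x a (r • v) = r • tmul x a v := by
  rw [← smul_tmul_left]; unfold tmul; rw [TensorProduct.smul_tmul]

/-- The map `v ↦ a ⊗ v`. -/
noncomputable def mk (a : Uq) : V →ₗ[ℂ] Twist x V where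
  toFun := tmul x a
  map_add' := tmul_add x a
  map_smul' r := tmul_smul_right x r a

@[simp] theorem mk_apply (a : Uq) (v : V) : mk x a v = tmul x a v := rfl

theorem tmul_induction {P : Twist x V → Prop} (h0 : P 0)
    (ht : ∀ a v, P (tmul x a v)) (ha : ∀ s t, P s → P t → P (s + t)) (t : Twist x V) : P t := by
  obtain ⟨t, rfl⟩ := Submodule.Quotient.mk_surjective (tensorRel V) t
  induction t using TensorProduct.induction_on with
  | zero => exact h0
  | tmul a v => exact ht a v
  | add s t hs ht => exact ha _ _ hs ht

/-- `u q^i ⊗ v = q^i Θ_{x+i}(u) ⊗ v`. -/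
theorem smul_zpow_tmul (u : U) (i : ℤ) (v : V) :
    u • tmul x ↑(Uq.qUnit ^ i) v =
      tmul x (↑(Uq.qUnit ^ i) * thetaHom (x + i) (Uq.ofU u)) v := by
  rw [smul_tmul]
  change tmul x (thetaHom x (Uq.ofU u) * _) v = _
  -- Moving q^i to the left of Θ_x(u) applies Θ_i to it; the two twists merge into Θ_{x+i}.
  rw [Uq.mul_qUnit_zpow, Uq.thetaHom_thetaHom, add_comm]

theorem mul_gen_tmul (a : Uq) (g : Gen) (v : V) :
    tmul x (a * Uq.gen g) v = tmul x a (U.gen g • v) :=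
  tmul_smul x _ _ _

/-! ### Comparison with the Ore localization of V, and injectivity of v ↦ 1 ⊗ v -/

variable (V) in
/-- The map from the twisted module to the localization of `V` at `q`. -/
noncomputable def toLocalization :
    Twist x V →ₗ[ℂ] OreLocalization (Submonoid.powers (U.gen .q)) V :=
  let S := Submonoid.powers (U.gen .q)
  let num : V →ₗ[ℂ] OreLocalization S V :=
    { toFun := fun v => v /ₒ (1 : S)
      map_add' := fun _ _ => OreLocalization.add_oreDiv.symm
      map_smul' := fun _ _ => (OreLocalization.smul_oreDiv_one _ _).symm }
  let F : Uq ⊗[ℂ] V →ₗ[Uq] OreLocalization S V :=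
    TensorProduct.AlgebraTensorModule.lift (LinearMap.toSpanSingleton Uq _ num)
  -- The map a ⊗ v ↦ a · (v/1) kills the tensor relations because u · (v/1) = (u v)/1. It is linear
  -- over the localization for the untwisted action; restricting scalars to ℂ makes the twist by x
  -- irrelevant.
  ((tensorRel V).liftQ F (Submodule.span_le.mpr <| by
    rintro _ ⟨a, u, v, rfl⟩
    simp only [SetLike.mem_coe, LinearMap.mem_ker, map_sub, F,
      TensorProduct.AlgebraTensorModule.lift_tmul]
    change (a * Uq.ofU u) • (v /ₒ (1 : S)) - a • ((u • v) /ₒ (1 : S)) = 0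
    rw [mul_smul, Uq.ofU_apply, OreLocalization.numeratorHom_apply,
      OreLocalization.smul_div_one, sub_self])).restrictScalars ℂ

theorem toLocalization_tmul_one (v : V) :
    toLocalization x V (tmul x 1 v) = v /ₒ (1 : Submonoid.powers (U.gen .q)) :=
  one_smul Uq (v /ₒ (1 : Submonoid.powers (U.gen .q)))

/-- If `q` acts injectively on `V`, then `V` embeds into the twisted module. -/
theorem eq_zero_of_tmul_one (hq : ∀ v : V, U.gen .q • v = 0 → v = 0) {v : V}
    (h : tmul x 1 v = 0) : v = 0 := by
  have h1 := toLocalization_tmul_one x v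
  rw [h, map_zero, OreLocalization.zero_def, OreLocalization.oreDiv_eq_iff] at h1
  -- Equality of the fractions 0/1 and v/1 means that some power q^m kills v; injectivity of q is
  -- then used m times.
  obtain ⟨⟨_, m, rfl⟩, w, h2, h3⟩ := h1
  simp only [OneMemClass.coe_one, mul_one, smul_zero] at h2 h3
  replace h2 : U.gen .q ^ m • v = 0 := by exact h2
  have h4 : ∀ k : ℕ, U.gen .q ^ k • v = 0 → v = 0 := by
    intro k
    induction k with
    | zero => intro hk; simpa using hk
    | succ k ih => intro hk; exact ih (hq _ (by rwa [pow_succ', mul_smul] at hk))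
  exact h4 m h2

/-- Θ fixes q, so powers of q shift the exponent with no correction even in the twisted action. This
serves to clear negative exponents in a linear relation. -/
theorem q_pow_smul_zpow_tmul (k : ℕ) (i : ℤ) (v : V) :
    U.gen .q ^ k • tmul x ↑(Uq.qUnit ^ i) v = tmul x ↑(Uq.qUnit ^ ((k : ℤ) + i)) v := by
  rw [smul_zpow_tmul, ← Uq.qUnit_pow, thetaHom_qUnit_zpow, ← Units.val_mul, ← zpow_add, add_comm]

end Twist
/-! ## Structure of `N(λ, c)` -/

namespace N

variable {n : ℕ} (c : ℂˣ)

theorem vec_fin (i : ℕ) (j : Fin (n + 1)) : vec n c i j = basis n c (i, j) := by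
  rw [vec, dif_pos j.2]

theorem q_smul_vec (i j : ℕ) (hj : j ≤ n) : U.gen .q • vec n c i j = vec n c (i + 1) j :=
  gen_smul_vec n c .q i j hj

theorem h_smul_vec (i j : ℕ) (hj : j ≤ n) :
    U.gen .h • vec n c i j = ((-1 / 2 + n : ℂ) - i - 2 * j) • vec n c i j :=
  gen_smul_vec n c .h i j hj

theorem f_pow_smul_vec (i j : ℕ) (hj : j ≤ n) : U.gen .f ^ j • vec n c i 0 = vec n c i j := by
  induction j with
  | zero => simp
  | succ j ih =>
    rw [pow_succ', mul_smul, ih (by omega), gen_smul_vec n c .f i j (by omega)]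
    exact if_pos (by omega)

theorem q_pow_smul_vec (i j k : ℕ) (hj : j ≤ n) :
    U.gen .q ^ k • vec n c i j = vec n c (i + k) j := by
  induction k with
  | zero => simp
  | succ k ih => rw [pow_succ', mul_smul, ih, q_smul_vec c _ _ hj, add_assoc]

/-- The action of `u` as a linear map. -/
noncomputable def lsmul (u : U) : N n c →ₗ[ℂ] N n c :=
  U.lift (act n c) (actRels c) u

theorem lsmul_apply (u : U) (w : N n c) : lsmul c u w = u • w := rfl

/-- Lowering the first index by one is a left inverse of q. Its truncated value at index 0 plays no
role, since the image of q only involves positive first indices. -/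
theorem q_smul_eq_zero {w : N n c} (hw : U.gen .q • w = 0) : w = 0 := by
  let L : N n c →ₗ[ℂ] N n c := (basis n c).constr ℂ fun ij => basis n c (ij.1 - 1, ij.2)
  have H : L ∘ₗ lsmul c (U.gen .q) = LinearMap.id := (basis n c).ext fun ⟨i, j⟩ => by
    rw [LinearMap.comp_apply, lsmul_apply, ← vec_fin, q_smul_vec c i j (by omega), vec_fin,
      Module.Basis.constr_basis, Nat.add_sub_cancel, LinearMap.id_apply, ← vec_fin]
  have := LinearMap.congr_fun H w
  rw [LinearMap.comp_apply, lsmul_apply, hw, map_zero] at this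
  exact this.symm

/-- Since h is diagonal in the basis, an eigenvector equation can be read off one coordinate at a
time. -/
theorem repr_h_smul (w : N n c) (ij : ℕ × Fin (n + 1)) :
    (basis n c).repr (U.gen .h • w) ij =
      ((-1 / 2 + n : ℂ) - ij.1 - 2 * (ij.2 : ℕ)) * (basis n c).repr w ij := by
  have H : (basis n c).coord ij ∘ₗ lsmul c (U.gen .h) =
      ((-1 / 2 + n : ℂ) - ij.1 - 2 * (ij.2 : ℕ)) • (basis n c).coord ij :=
    (basis n c).ext fun kl => by
      rw [LinearMap.comp_apply, lsmul_apply, ← Prod.mk.eta (p := kl), ← vec_fin,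
        h_smul_vec c _ _ (by omega), map_smul, vec_fin, LinearMap.smul_apply]
      by_cases h : kl = ij
      · rw [h]
      · simp [h]
  exact LinearMap.congr_fun H w

theorem vec_zero_zero_ne_zero : vec n c 0 0 ≠ 0 := by
  rw [vec, dif_pos n.succ_pos]
  exact (basis n c).ne_zero _

/-- The highest weight vectors are the nonzero multiples of `v_{0,0}`. -/
theorem eq_smul_of_isHighestWeightVector {v : N n c} (hv : IsHighestWeightVector v) :
    ∃ a : ℂ, a ≠ 0 ∧ v = a • vec n c 0 0 := by
  obtain ⟨hv0, μ, ⟨-, hmax⟩, hμ⟩ := hv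
  have hrepr : ∀ ij : ℕ × Fin (n + 1), (basis n c).repr v ij ≠ 0 →
      μ = (-1 / 2 + n : ℂ) - ij.1 - 2 * (ij.2 : ℕ) := fun ij h => by
    have := repr_h_smul c v ij
    rw [hμ, map_smul, Finsupp.smul_apply, smul_eq_mul] at this
    exact mul_right_cancel₀ h this
  have hne : ∃ ij, (basis n c).repr v ij ≠ 0 := by
    by_contra! H
    exact hv0 ((basis n c).ext_elem fun ij => by simp [H ij])
  obtain ⟨ij, hij⟩ := hne
  -- A coordinate (i, j) in the support of v gives μ = λ - (i + 2j). Thus the weight λ of v_{0,0}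
  -- exceeds μ by a natural number, and maximality of μ forces equality.
  have hmu : (-1 / 2 + n : ℂ) = μ := hmax _
    ⟨vec n c 0 0, vec_zero_zero_ne_zero c, by
      rw [h_smul_vec c 0 0 n.zero_le]; simp⟩
    ⟨ij.1 + 2 * ij.2, by rw [hrepr ij hij]; push_cast; ring⟩
  -- With μ = λ, any (k, l) in the support satisfies k + 2l = 0.
  have hzero : ∀ kl : ℕ × Fin (n + 1), (basis n c).repr v kl ≠ 0 → kl = (0, 0) :=
    fun ⟨k, l⟩ h => by
      have h1 := hrepr _ h
      rw [← hmu] at h1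
      have h2 : ((k + 2 * (l : ℕ) : ℕ) : ℂ) = 0 := by
        push_cast
        linear_combination (norm := (push_cast; ring)) h1
      have h3 : k + 2 * (l : ℕ) = 0 := by exact_mod_cast h2
      have h4 : l = 0 := Fin.ext (by rw [Fin.val_zero]; omega)
      rw [h4, show k = 0 by omega]
  have hv' : v = (basis n c).repr v (0, 0) • vec n c 0 0 := (basis n c).ext_elem fun kl => by
    rw [show vec n c 0 0 = basis n c (0, 0) from vec_fin c 0 0, map_smul, Finsupp.smul_apply,
      Module.Basis.repr_self, smul_eq_mul]
    by_cases h : kl = (0, 0)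
    · simp [h]
    · rw [Finsupp.single_eq_of_ne h, mul_zero]
      exact not_not.mp fun h' => h (hzero kl h')
  refine ⟨_, fun h => hv0 ?_, hv'⟩
  rw [hv', h, zero_smul]

end N

/-! ## The vectors `v_{i,j}` -/

section TwistVec

variable {n : ℕ} (c : ℂˣ) (x : ℂ)

/-- Carrying f^j across the tensor sign leaves only q^i on the left, the one factor past which
Θ_x(u) must be commuted. -/
theorem twistVec_eq_tmul {V : Type*} [AddCommGroup V] [Module ℂ V] [Module U V]
    [IsScalarTower ℂ U V] (v : V) (i : ℤ) (j : ℕ) :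
    twistVec x v i j = Twist.tmul x ↑(Uq.qUnit ^ i) (U.gen .f ^ j • v) := by
  rw [← Twist.tmul_smul, map_pow]; rfl

theorem twistVec_smul {V : Type*} [AddCommGroup V] [Module ℂ V] [Module U V]
    [IsScalarTower ℂ U V] (a : ℂ) (v : V) (i : ℤ) (j : ℕ) :
    twistVec x (a • v) i j = a • twistVec x v i j :=
  Twist.tmul_smul_right x a _ v

/-- `q^i ⊗ v_{k,j} = q^{i+k} f^j ⊗ v_{0,0}`. -/
theorem tmul_vec (i : ℤ) (k j : ℕ) (hj : j ≤ n) :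
    Twist.tmul x ↑(Uq.qUnit ^ i) (N.vec n c k j) = twistVec x (N.vec n c 0 0) (i + k) j := by
  -- In N(λ, c), v_{k,j} = q^k f^j v_{0,0}, and q^k passes through the tensor product to join q^i.
  rw [twistVec_eq_tmul, N.f_pow_smul_vec c 0 j hj, ← Nat.zero_add k, ← N.q_pow_smul_vec c 0 j k hj,
    ← Twist.tmul_smul, ← Uq.qUnit_pow, ← Units.val_mul, ← zpow_add, Nat.zero_add]

/-! ### Linear independence and spanning -/

theorem linearIndependent_twistVec :
    LinearIndependent ℂ fun ij : ℤ × Fin (n + 1) => twistVec x (N.vec n c 0 0) ij.1 ij.2 := by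
  rw [linearIndependent_iff']
  intro s g hg
  obtain ⟨m, hm⟩ : ∃ m : ℕ, ∀ ij ∈ s, 0 ≤ (m : ℤ) + ij.1 := by
    -- The sum of all |i| over the support bounds each |i|, hence makes every exponent m + i
    -- nonnegative.
    refine ⟨∑ ij ∈ s, ij.1.natAbs, fun ij hij => ?_⟩
    have : ij.1.natAbs ≤ ∑ ij ∈ s, ij.1.natAbs :=
      Finset.single_le_sum (f := fun ij : ℤ × Fin (n + 1) => ij.1.natAbs)
        (fun _ _ => Nat.zero_le _) hij
    omega
  have h1 := congrArg (U.gen .q ^ m • ·) hg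
  -- After multiplication by q^m, each term lies in the image of N(λ, c) under w ↦ 1 ⊗ w.
  have h2 : ∀ ij ∈ s, U.gen .q ^ m • g ij • twistVec x (N.vec n c 0 0) ij.1 ij.2 =
      Twist.mk x 1 (g ij • N.basis n c (((m : ℤ) + ij.1).toNat, ij.2)) := fun ij hij => by
    have e1 := tmul_vec (n := n) c x 0 ((m : ℤ) + ij.1).toNat ij.2 (by omega)
    rw [zpow_zero, Units.val_one, Int.toNat_of_nonneg (hm ij hij), zero_add] at e1
    rw [smul_comm, twistVec_eq_tmul, Twist.q_pow_smul_zpow_tmul,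
      N.f_pow_smul_vec c _ _ (by omega), tmul_vec c x _ _ _ (by omega), map_smul, Twist.mk_apply,
      ← N.vec_fin, e1, Nat.cast_zero, add_zero]
  simp only [Finset.smul_sum, smul_zero] at h1
  rw [Finset.sum_congr rfl h2, ← map_sum] at h1
  have h3 := Twist.eq_zero_of_tmul_one x (fun w => N.q_smul_eq_zero c) h1
  intro ij hij
  -- The passage to natural exponents loses nothing on s, so distinct terms of the relation give
  -- distinct basis vectors of N(λ, c).
  have hinj : Set.InjOn (fun ij : ℤ × Fin (n + 1) => (((m : ℤ) + ij.1).toNat, ij.2)) s := by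
    rintro ⟨i, j⟩ h ⟨k, l⟩ h' H
    have e1 := hm _ h
    have e2 := hm _ h'
    simp only [Prod.mk.injEq] at H e1 e2 ⊢
    exact ⟨by omega, H.2⟩
  have h4 := (N.basis n c).linearIndependent.comp
    (fun ij : s => ((((m : ℤ) + ij.1.1).toNat, ij.1.2) : ℕ × Fin (n + 1)))
    (fun a b h => Subtype.ext (hinj a.2 b.2 h))
  rw [← Finset.sum_coe_sort] at h3
  exact linearIndependent_iff'.mp h4 Finset.univ (fun ij => g ij) h3 ⟨ij, hij⟩ (Finset.mem_univ _)

/-- Writing a = q^m u, the tensor a ⊗ w equals q^m ⊗ u w; expanding u w in the basis of N(λ, c)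
leaves vectors q^m ⊗ v_{i,j}, each of which is in the family. -/
theorem span_twistVec :
    ⊤ ≤ Submodule.span ℂ
      (Set.range fun ij : ℤ × Fin (n + 1) => twistVec x (N.vec n c 0 0) ij.1 ij.2) := by
  rintro t -
  induction t using Twist.tmul_induction with
  | h0 => exact zero_mem _
  | ha s t hs ht => exact add_mem hs ht
  | ht a w =>
    obtain ⟨m, u, rfl⟩ := Uq.exists_eq_zpow_mul a
    rw [Twist.tmul_smul, ← Twist.mk_apply]
    refine Submodule.span_induction (p := fun w _ => Twist.mk x _ w ∈ _) ?_ ?_ ?_ ?_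
      ((N.basis n c).mem_span (u • w))
    · rintro _ ⟨⟨i, j⟩, rfl⟩
      rw [← N.vec_fin, Twist.mk_apply, tmul_vec c x _ _ _ (by omega)]
      exact Submodule.subset_span ⟨(m + i, j), rfl⟩
    · rw [map_zero]; exact zero_mem _
    · intro a b _ _ ha hb; rw [map_add]; exact add_mem ha hb
    · intro r a _ ha; rw [map_smul]; exact Submodule.smul_mem _ r ha

/-! ### The action of the generators -/

/-- All dependence on i and x beyond the prefactor q^i is now in Θ_{x+i}. The vector on the right
has first index 0, so the terms of the action on N(λ, c) with a factor i drop out. -/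
theorem smul_twistVec (g : Gen) (i : ℤ) (j : ℕ) (hj : j ≤ n) :
    U.gen g • twistVec x (N.vec n c 0 0) i j =
      Twist.tmul x (↑(Uq.qUnit ^ i) * thetaGen (x + i) g) (N.vec n c 0 j) := by
  rw [twistVec_eq_tmul, N.f_pow_smul_vec c 0 j hj, Twist.smul_zpow_tmul, ← thetaHom_gen]
  rfl

theorem q_smul_twistVec (i : ℤ) (j : ℕ) (hj : j ≤ n) :
    U.gen .q • twistVec x (N.vec n c 0 0) i j = twistVec x (N.vec n c 0 0) (i + 1) j := by
  rw [smul_twistVec c x _ i j hj, thetaGen, Twist.mul_gen_tmul, N.q_smul_vec c _ _ hj,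
    tmul_vec c x _ _ _ hj]
  rfl

theorem f_smul_twistVec (i : ℤ) (j : ℕ) (hj : j < n) :
    U.gen .f • twistVec x (N.vec n c 0 0) i j = twistVec x (N.vec n c 0 0) i (j + 1) := by
  rw [smul_twistVec c x _ i j hj.le, thetaGen, Twist.mul_gen_tmul, N.gen_smul_vec n c _ _ _ hj.le,
    N.actVec, if_pos hj, tmul_vec c x _ _ _ hj, Nat.cast_zero, add_zero]

theorem f_smul_twistVec_top (i : ℤ) :
    U.gen .f • twistVec x (N.vec n c 0 0) i n =
      -∑ s ∈ Finset.range (n + 1),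
        (1 / (2 * (c : ℂ)) ^ (n + 1 - s) * ((n + 1).choose s : ℂ)) •
          twistVec x (N.vec n c 0 0) (i + 2 * ((n : ℤ) + 1 - s)) s := by
  rw [smul_twistVec c x _ i n le_rfl, thetaGen, Twist.mul_gen_tmul,
    N.gen_smul_vec n c _ _ _ le_rfl, N.actVec, if_neg (lt_irrefl n), N.top, ← Twist.mk_apply,
    map_neg, map_sum]
  congr 1
  refine Finset.sum_congr rfl fun s hs => ?_
  have hs' : s ≤ n := by have := Finset.mem_range.mp hs; omega
  rw [map_smul, Twist.mk_apply, tmul_vec c x _ _ _ hs']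
  -- Since s ≤ n, the truncated exponent in N(λ, c) agrees with the integer one.
  congr 2
  omega

theorem z_smul_twistVec (i : ℤ) (j : ℕ) (hj : j ≤ n) :
    U.gen .z • twistVec x (N.vec n c 0 0) i j = (c : ℂ) • twistVec x (N.vec n c 0 0) i j := by
  rw [smul_twistVec c x _ i j hj, thetaGen, Twist.mul_gen_tmul, N.gen_smul_vec n c _ _ _ hj,
    N.actVec, Twist.tmul_smul_right, tmul_vec c x _ _ _ hj, Nat.cast_zero, add_zero]

theorem h_smul_twistVec (i : ℤ) (j : ℕ) (hj : j ≤ n) :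
    U.gen .h • twistVec x (N.vec n c 0 0) i j =
      ((-1 / 2 + n : ℂ) - (i + x) - 2 * j) • twistVec x (N.vec n c 0 0) i j := by
  rw [smul_twistVec c x _ i j hj, thetaGen, mul_sub, sub_eq_add_neg, ← mul_neg,
    Algebra.algebraMap_eq_smul_one, ← neg_smul, mul_smul_comm, mul_one, Twist.add_tmul,
    Twist.smul_tmul_left, Twist.mul_gen_tmul, N.h_smul_vec c _ _ hj, Twist.tmul_smul_right,
    tmul_vec c x _ _ _ hj, Nat.cast_zero, Nat.cast_zero, add_zero]
  module

/-- On v_{0,j}, p contributes only the term in v_{1,j-1}; the correction (x + i) q⁻¹ z of Θ_{x+i}(p)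
supplies the term c(i + x). For j = 0 the truncated index j - 1 occurs with coefficient 0. -/
theorem p_smul_twistVec (i : ℤ) (j : ℕ) (hj : j ≤ n) :
    U.gen .p • twistVec x (N.vec n c 0 0) i j =
      -(j : ℂ) • twistVec x (N.vec n c 0 0) (i + 1) (j - 1) +
        ((c : ℂ) * (i + x)) • twistVec x (N.vec n c 0 0) (i - 1) j := by
  rw [smul_twistVec c x _ i j hj, thetaGen, mul_add, mul_smul_comm, ← mul_assoc, ← Units.val_mul,
    ← zpow_sub_one, Twist.add_tmul, Twist.smul_tmul_left, Twist.mul_gen_tmul, Twist.mul_gen_tmul,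
    N.gen_smul_vec n c _ _ _ hj, N.gen_smul_vec n c _ _ _ hj]
  simp only [N.actVec, Twist.tmul_add, Twist.tmul_smul_right, tmul_vec c x _ _ _ hj,
    tmul_vec c x _ _ (j - 1) (show j - 1 ≤ n by omega)]
  simp only [Nat.cast_zero, Nat.zero_add, Nat.cast_one, add_zero]
  module

/-- On v_{0,j}, e gives j(λ + 1 - j) v_{0,j-1}, while (x + i) q⁻¹ p gives -j(x + i) times the same
vector because q⁻¹ undoes the shift to v_{1,j-1}. Together they form the first coefficient; the q⁻²
z term gives the second. -/
theorem e_smul_twistVec (i : ℤ) (j : ℕ) (hj : j ≤ n) :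
    U.gen .e • twistVec x (N.vec n c 0 0) i j =
      ((j : ℂ) * ((-1 / 2 + n : ℂ) + 1 - (i + x) - j)) • twistVec x (N.vec n c 0 0) i (j - 1) +
        (1 / 2 * (c : ℂ) * (i + x) * ((i + x) - 1)) • twistVec x (N.vec n c 0 0) (i - 2) j := by
  rw [smul_twistVec c x _ i j hj, thetaGen, mul_add, mul_add, mul_smul_comm, mul_smul_comm,
    ← mul_assoc, ← mul_assoc, ← Units.val_mul, ← Units.val_mul, ← zpow_sub_one, ← zpow_add,
    Twist.add_tmul, Twist.add_tmul, Twist.smul_tmul_left, Twist.smul_tmul_left,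
    Twist.mul_gen_tmul, Twist.mul_gen_tmul, Twist.mul_gen_tmul, N.gen_smul_vec n c _ _ _ hj,
    N.gen_smul_vec n c _ _ _ hj, N.gen_smul_vec n c _ _ _ hj]
  simp only [N.actVec, Twist.tmul_add, Twist.tmul_smul_right, tmul_vec c x _ _ _ hj,
    tmul_vec c x _ _ (j - 1) (show j - 1 ≤ n by omega)]
  simp only [Nat.cast_zero, Nat.zero_add, Nat.cast_one, add_zero, sub_add_cancel,
    ← sub_eq_add_neg]
  module

end TwistVec
end Schrodinger

/-! ### The proposition, for an arbitrary highest weight vector -/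

open Schrodinger
theorem proposition4p6 (n : ℕ) (lam : ℂ) (hlam : lam = -1 / 2 + n) (c : ℂˣ) (x : ℂ)
    (v : N n c) (hv : IsHighestWeightVector v) :
    (∃ b : Module.Basis (ℤ × Fin (n + 1)) ℂ (Twist x (N n c)),
      ∀ (i : ℤ) (j : Fin (n + 1)), b (i, j) = twistVec x v i j) ∧
    ∀ (i : ℤ) (j : ℕ), j ≤ n →
      U.gen .q • twistVec x v i j = twistVec x v (i + 1) j ∧
      (j < n → U.gen .f • twistVec x v i j = twistVec x v i (j + 1)) ∧
      (j = n → U.gen .f • twistVec x v i j =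
        -∑ s ∈ Finset.range (n + 1),
          (1 / (2 * (c : ℂ)) ^ (n + 1 - s) * ((n + 1).choose s : ℂ)) •
            twistVec x v (i + 2 * ((n : ℤ) + 1 - s)) s) ∧
      U.gen .z • twistVec x v i j = (c : ℂ) • twistVec x v i j ∧
      U.gen .h • twistVec x v i j = (lam - (i + x) - 2 * j) • twistVec x v i j ∧
      U.gen .p • twistVec x v i j =
        -(j : ℂ) • twistVec x v (i + 1) (j - 1) + ((c : ℂ) * (i + x)) • twistVec x v (i - 1) j ∧
      U.gen .e • twistVec x v i j =
        ((j : ℂ) * (lam + 1 - (i + x) - j)) • twistVec x v i (j - 1) +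
          (1 / 2 * (c : ℂ) * (i + x) * ((i + x) - 1)) • twistVec x v (i - 2) j := by
  obtain ⟨a, ha, rfl⟩ := N.eq_smul_of_isHighestWeightVector c hv
  subst hlam
  -- For v = a v_{0,0} the family is the one for v_{0,0} scaled by the unit a, and each action
  -- formula follows by pulling a out of both sides.
  refine ⟨⟨(Module.Basis.mk (linearIndependent_twistVec c x) (span_twistVec c x)).unitsSMul
    fun _ => Units.mk0 a ha, fun i j => ?_⟩, fun i j hj => ⟨?_, fun hj' => ?_, ?_, ?_, ?_, ?_, ?_⟩⟩
  · rw [Module.Basis.unitsSMul_apply, Module.Basis.mk_apply, twistVec_smul]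
    rfl
  · simp only [twistVec_smul, smul_comm _ a, q_smul_twistVec c x i j hj]
  · simp only [twistVec_smul, smul_comm _ a, f_smul_twistVec c x i j hj']
  · rintro rfl
    simp only [twistVec_smul, smul_comm _ a, f_smul_twistVec_top c x i, smul_neg, Finset.smul_sum]
  · simp only [twistVec_smul, smul_comm _ a, z_smul_twistVec c x i j hj]
  · simp only [twistVec_smul, smul_comm _ a, h_smul_twistVec c x i j hj]
  · simp only [twistVec_smul, smul_comm _ a, p_smul_twistVec c x i j hj, smul_add]
  · simp only [twistVec_smul, smul_comm _ a, e_smul_twistVec c x i j hj, smul_add]
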